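/- Let $J=2$, let $f\colon\mathbb{R}^2\to\left]-\infty,+\infty\right]$ be the negative entropy, $f(x)=\sum_{j}(x_j\ln x_j-x_j)$ if $x\in[0,+\infty[^2$ (with $0\ln 0=0$) and $f(x)=+\infty$ otherwise, and let $U=\operatorname{int}\operatorname{dom} f$. Let $D$ be the Bregman distance of $f$, that is, $D(x,y)=f(x)-f(y)-\langle\nabla f(y),x-y\rangle$ if $y\in U$ and $D(x,y)=+\infty$ otherwise. Then $U=\left]0,+\infty\right[^2$, and $D$ is the Kullback--Leibler divergence: $D(x,y)=\sum_{j}\big(x_j\ln(x_j/y_j)-x_j+y_j\big)$ if $x\in[0,+\infty[^2$ and $y\in\left]0,+\infty\right[^2$, and $D(x,y)=+\infty$ otherwise. Let $a>1$, $c_0=(1,a)$, $c_1=(a,1)$, and let $C=\operatorname{conv}\{c_0,c_1\}$ be the segment between $c_0$ and $c_1$. For $x\in\mathbb{R}^2$ put $F_C(x)=\sup_{c\in C}D(x,c)$. For $x\in\operatorname{dom} f$ let $Q_C(x)=\{c\in C : D(x,c)=F_C(x)\}$ be the set of farthest points of $x$ in $C$, and let $Q_C(x)=\varnothing$ for all other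 $x$. Then, for every $x=(x_1,x_2)\in U$, $$Q_C(x)=\begin{cases}\{c_0\},&\text{if } x_2<x_1;\\ \{c_1\},&\text{if } x_1<x_2;\\ \{c_0,c_1\},&\text{if } x_1=x_2.\end{cases}$$ Moreover, the Chebyshev center of $C$ with respect to $D$, that is, the unique minimizer of $F_C$ over $\mathbb{R}^2$, which lies in $\operatorname{dom} f$, exists and is $z=(\sqrt a,\sqrt a)$. This is the (coordinatewise) geometric mean of $c_0$ and $c_1$. -/

import Mathlib

namespace RightBregman

/-- The essential domain of an extended-real-valued function: the points where it is finite. -/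
def effDomain {J : ℕ} (f : EuclideanSpace ℝ (Fin J) → EReal) : Set (EuclideanSpace ℝ (Fin J)) :=
  {x | f x ≠ ⊤ ∧ f x ≠ ⊥}

open Classical in
/-- The Bregman distance of `f`: for `y` in the interior of the domain of `f` it is
`f x - f y - ⟪∇ f y, x - y⟫`, and `+∞` for all other `y`. Near such a `y` the function `f` is
finite, so it agrees there with `fun z => (f z).toReal`. -/
noncomputable def bregmanDist {J : ℕ} (f : EuclideanSpace ℝ (Fin J) → EReal)
    (x y : EuclideanSpace ℝ (Fin J)) : EReal :=
  if y ∈ interior (effDomain f) then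
    f x - f y - ((inner ℝ (gradient (fun z => (f z).toReal) y) (x - y) : ℝ) : EReal)
  else ⊤

/-- The right farthest-distance function of `C`: `x ↦ sup_{c ∈ C} D(x, c)`. -/
noncomputable def farthestDist {J : ℕ} (f : EuclideanSpace ℝ (Fin J) → EReal)
    (C : Set (EuclideanSpace ℝ (Fin J))) (x : EuclideanSpace ℝ (Fin J)) : EReal :=
  ⨆ c ∈ C, bregmanDist f x c

/-- The right farthest-point map of `C`: the set of all `c ∈ C` that maximize `D(x, ·)` over `C`
if `x` is in the domain of `f`, and the empty set otherwise. -/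
def farthestPoints {J : ℕ} (f : EuclideanSpace ℝ (Fin J) → EReal)
    (C : Set (EuclideanSpace ℝ (Fin J))) (x : EuclideanSpace ℝ (Fin J)) :
    Set (EuclideanSpace ℝ (Fin J)) :=
  {c | x ∈ effDomain f ∧ c ∈ C ∧ bregmanDist f x c = farthestDist f C x}

/-- `z` is the right Chebyshev center of `C`: it lies in the domain of `f` and is the unique
minimizer, over the whole space, of the right farthest-distance function. -/
def IsChebyshevCenter {J : ℕ} (f : EuclideanSpace ℝ (Fin J) → EReal)
    (C : Set (EuclideanSpace ℝ (Fin J))) (z : EuclideanSpace ℝ (Fin J)) : Prop :=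
  z ∈ effDomain f ∧ {w | ∀ y, farthestDist f C w ≤ farthestDist f C y} = {z}

open Classical in
/-- The negative entropy (`0 * log 0 = 0`). -/
noncomputable def negEntropy (J : ℕ) (x : EuclideanSpace ℝ (Fin J)) : EReal :=
  if ∀ j, 0 ≤ x j then ((∑ j, (x j * Real.log (x j) - x j) : ℝ) : EReal) else ⊤

open Classical in
/-- The Kullback-Leibler divergence (`0 * log 0 = 0`). -/
noncomputable def klDist {J : ℕ} (x y : EuclideanSpace ℝ (Fin J)) : EReal :=
  if (∀ j, 0 ≤ x j) ∧ ∀ j, 0 < y j then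
    ((∑ j, (x j * Real.log (x j / y j) - x j + y j) : ℝ) : EReal)
  else ⊤

/-- The point `(1, a)` of the plane. -/
noncomputable def c₀ (a : ℝ) : EuclideanSpace ℝ (Fin 2) := !₂[1, a]

/-- The point `(a, 1)` of the plane. -/
noncomputable def c₁ (a : ℝ) : EuclideanSpace ℝ (Fin 2) := !₂[a, 1]

/-- The segment between `(1, a)` and `(a, 1)`. -/
def segmentC (a : ℝ) : Set (EuclideanSpace ℝ (Fin 2)) := convexHull ℝ {c₀ a, c₁ a}

end RightBregman

/-!
The gradient of the negative entropy at a point `y` with positive coordinates is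
`(log y j)_j`, so its Bregman distance is the Kullback-Leibler divergence
(`bregmanDist_negEntropy`).

A point of the segment is `c = (1 - t) • c₀ a + t • c₁ a`, and all such points have the
coordinate sum `1 + a`. For `x ≥ 0` the distance from `x` to `c` is therefore
`K x - x 0 * log (c 0) - x 1 * log (c 1)`, where `K x` does not depend on `c`. Concavity of the
logarithm gives `log (c 0) ≥ t * log a` and `log (c 1) ≥ (1 - t) * log a`, strictly unless `c` is
an end point. Hence the distance is at most `K x - log a * min (x 0) (x 1)`, the bound is attained
at an end point, and for `x > 0` only at end points: this gives the farthest-distance function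
(`farthestDist_segmentC`) and the farthest points.

Bounding the minimum by the mean of the two coordinates, with `s = √a` and `log s = log a / 2`,
the farthest distance is at least `∑ j, (x j * log (x j / s) - x j + s) + (1 + a - 2 * s)`. Each
summand is nonnegative and vanishes only for `x j = s`, and at `x = (s, s)` the lower bound is an
equality, so `(s, s)` is the unique minimizer.
-/

namespace RightBregman

/-! ### The Bregman distance of the negative entropy -/

theorem effDomain_negEntropy (J : ℕ) : effDomain (negEntropy J) = {x | ∀ j, 0 ≤ x j} := by
  ext x
  by_cases h : ∀ j, 0 ≤ x j
  · simp only [effDomain, negEntropy, Set.mem_ofPred_eq, if_pos h]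
    exact ⟨fun _ => h, fun _ => ⟨EReal.coe_ne_top _, EReal.coe_ne_bot _⟩⟩
  · simp [effDomain, negEntropy, h]

theorem interior_effDomain_negEntropy (J : ℕ) :
    interior (effDomain (negEntropy J)) = {x | ∀ j, 0 < x j} := by
  have hpre : {x : EuclideanSpace ℝ (Fin J) | ∀ j, 0 ≤ x j}
      = (EuclideanSpace.equiv (Fin J) ℝ).toHomeomorph ⁻¹' (Set.univ.pi fun _ => Set.Ici 0) := by
    ext x
    exact Set.mem_univ_pi.symm
  rw [effDomain_negEntropy, hpre,
    ← (EuclideanSpace.equiv (Fin J) ℝ).toHomeomorph.preimage_interior,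
    interior_pi_set Set.finite_univ]
  simp only [interior_Ici]
  ext x
  exact Set.mem_univ_pi

theorem hasGradientAt_negEntropy {J : ℕ} {y : EuclideanSpace ℝ (Fin J)} (hy : ∀ j, 0 < y j) :
    HasGradientAt (fun z => (negEntropy J z).toReal)
      (WithLp.toLp 2 fun j => Real.log (y j)) y := by
  have hsum : HasFDerivAt (fun z : EuclideanSpace ℝ (Fin J) => ∑ j, (z j * Real.log (z j) - z j))
      (∑ j, Real.log (y j) • (EuclideanSpace.proj j : EuclideanSpace ℝ (Fin J) →L[ℝ] ℝ)) y := by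
    refine HasFDerivAt.fun_sum fun j _ => ?_
    have h : HasDerivAt (fun t : ℝ => t * Real.log t - t) (Real.log (y j)) (y j) := by
      simpa using (Real.hasDerivAt_mul_log (hy j).ne').fun_sub (hasDerivAt_id' (y j))
    exact h.comp_hasFDerivAt y
      (EuclideanSpace.proj j : EuclideanSpace ℝ (Fin J) →L[ℝ] ℝ).hasFDerivAt
  rw [hasGradientAt_iff_hasFDerivAt]
  refine (hsum.congr_fderiv ?_).congr_of_eventuallyEq ?_
  · ext v
    simp [PiLp.inner_apply, mul_comm]
  · have hU : {x : EuclideanSpace ℝ (Fin J) | ∀ j, 0 < x j} ∈ nhds y := by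
      rw [← interior_effDomain_negEntropy]
      exact isOpen_interior.mem_nhds (by rwa [interior_effDomain_negEntropy])
    filter_upwards [hU] with z hz
    have hz' : ∀ j, 0 ≤ z j := fun j => (hz j).le
    rw [negEntropy, if_pos hz', EReal.toReal_coe]

theorem mul_log_div_eq {x y : ℝ} (hy : 0 < y) :
    x * Real.log (x / y) = x * Real.log x - x * Real.log y := by
  rcases eq_or_ne x 0 with rfl | hx
  · simp
  · rw [Real.log_div hx hy.ne', mul_sub]

theorem bregmanDist_negEntropy {J : ℕ} (x y : EuclideanSpace ℝ (Fin J)) :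
    bregmanDist (negEntropy J) x y = klDist x y := by
  by_cases hy : ∀ j, 0 < y j
  · have hy' : ∀ j, 0 ≤ y j := fun j => (hy j).le
    have hmem : y ∈ interior (effDomain (negEntropy J)) := by
      rwa [interior_effDomain_negEntropy]
    rw [bregmanDist, if_pos hmem, (hasGradientAt_negEntropy hy).gradient]
    by_cases hx : ∀ j, 0 ≤ x j
    · rw [klDist, if_pos ⟨hx, hy⟩, negEntropy, negEntropy, if_pos hx, if_pos hy']
      norm_cast
      simp only [PiLp.inner_apply, ← Finset.sum_sub_distrib]
      refine Finset.sum_congr rfl fun j _ => ?_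
      simp only [mul_log_div_eq (hy j), PiLp.sub_apply, RCLike.inner_apply, conj_trivial]
      ring
    · have hx' : ¬ ((∀ j, 0 ≤ x j) ∧ ∀ j, 0 < y j) := fun h => hx h.1
      rw [klDist, if_neg hx', negEntropy, negEntropy, if_neg hx, if_pos hy',
        EReal.top_sub_coe, EReal.top_sub_coe]
  · have hmem : y ∉ interior (effDomain (negEntropy J)) := by
      rwa [interior_effDomain_negEntropy]
    have hy' : ¬ ((∀ j, 0 ≤ x j) ∧ ∀ j, 0 < y j) := fun h => hy h.2
    rw [bregmanDist, if_neg hmem, klDist, if_neg hy']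

/-! ### Farthest distance and farthest points -/

/-- The part of the divergence from `x` to a point of coordinate sum `1 + a` that does not depend
on that point. -/
noncomputable def klConst (a : ℝ) (x : EuclideanSpace ℝ (Fin 2)) : ℝ :=
  (x 0 * Real.log (x 0) - x 0) + (x 1 * Real.log (x 1) - x 1) + (1 + a)

theorem mem_segmentC_iff {a : ℝ} {c : EuclideanSpace ℝ (Fin 2)} :
    c ∈ segmentC a ↔ ∃ t : ℝ, 0 ≤ t ∧ t ≤ 1 ∧ c = !₂[1 - t + t * a, (1 - t) * a + t] := by
  rw [segmentC, convexHull_pair, segment_eq_image]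
  simp only [Set.mem_image, Set.mem_Icc, and_assoc]
  refine exists_congr fun t => and_congr_right fun _ => and_congr_right fun _ => ?_
  have h : (1 - t) • c₀ a + t • c₁ a = !₂[1 - t + t * a, (1 - t) * a + t] := by
    ext j
    fin_cases j <;> simp [c₀, c₁]
  rw [h, eq_comm]

theorem c₀_mem_segmentC (a : ℝ) : c₀ a ∈ segmentC a := subset_convexHull ℝ _ (by simp)

theorem c₁_mem_segmentC (a : ℝ) : c₁ a ∈ segmentC a := subset_convexHull ℝ _ (by simp)

theorem c₀_ne_c₁ {a : ℝ} (ha : 1 < a) : c₀ a ≠ c₁ a := fun h => by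
  have h0 := congrArg (fun c : EuclideanSpace ℝ (Fin 2) => c 0) h
  simp only [c₀, c₁, PiLp.toLp_apply, Matrix.cons_val_zero] at h0
  exact ha.ne h0

theorem bregmanDist_eq_klConst_sub {a : ℝ} {x c : EuclideanSpace ℝ (Fin 2)}
    (hx : ∀ j, 0 ≤ x j) (hc : ∀ j, 0 < c j) (hsum : c 0 + c 1 = 1 + a) :
    bregmanDist (negEntropy 2) x c
      = ((klConst a x - (x 0 * Real.log (c 0) + x 1 * Real.log (c 1)) : ℝ) : EReal) := by
  rw [bregmanDist_negEntropy, klDist, if_pos ⟨hx, hc⟩, EReal.coe_eq_coe_iff, Fin.sum_univ_two,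
    mul_log_div_eq (hc 0), mul_log_div_eq (hc 1), klConst]
  linarith

theorem bregmanDist_c₀ {a : ℝ} (ha : 1 < a) {x : EuclideanSpace ℝ (Fin 2)} (hx : ∀ j, 0 ≤ x j) :
    bregmanDist (negEntropy 2) x (c₀ a) = ((klConst a x - x 1 * Real.log a : ℝ) : EReal) := by
  rw [bregmanDist_eq_klConst_sub (a := a) hx]
  · simp [c₀]
  · simp [c₀, Fin.forall_fin_two, one_pos.trans ha]
  · simp [c₀]

theorem bregmanDist_c₁ {a : ℝ} (ha : 1 < a) {x : EuclideanSpace ℝ (Fin 2)} (hx : ∀ j, 0 ≤ x j) :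
    bregmanDist (negEntropy 2) x (c₁ a) = ((klConst a x - x 0 * Real.log a : ℝ) : EReal) := by
  rw [bregmanDist_eq_klConst_sub (a := a) hx]
  · simp [c₁]
  · simp [c₁, Fin.forall_fin_two, one_pos.trans ha]
  · simp [c₁, add_comm]

theorem mul_log_lt_log_add {a t : ℝ} (ha : 1 < a) (ht0 : 0 < t) (ht1 : t < 1) :
    t * Real.log a < Real.log (1 - t + t * a) := by
  have h := strictConcaveOn_log_Ioi.2 (Set.mem_Ioi.2 one_pos)
    (Set.mem_Ioi.2 (one_pos.trans ha)) ha.ne (sub_pos.2 ht1) ht0 (sub_add_cancel 1 t)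
  simpa using h

/-- The divergence is strictly convex along the segment, so it stays below its larger value at
the two end points. -/
theorem bregmanDist_lt_of_mem_segmentC {a : ℝ} (ha : 1 < a) {x c : EuclideanSpace ℝ (Fin 2)}
    (hx : ∀ j, 0 ≤ x j) (hx' : ∃ j, 0 < x j) (hc : c ∈ segmentC a)
    (hc₀ : c ≠ c₀ a) (hc₁ : c ≠ c₁ a) :
    bregmanDist (negEntropy 2) x c
      < ((klConst a x - min (x 0) (x 1) * Real.log a : ℝ) : EReal) := by
  obtain ⟨t, ht0, ht1, rfl⟩ := mem_segmentC_iff.1 hc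
  have ht0 : 0 < t := ht0.lt_of_ne fun h => hc₀ (by simp [c₀, ← h])
  have ht1 : t < 1 := ht1.lt_of_ne fun h => hc₁ (by simp [c₁, h])
  have hlog : 0 < Real.log a := Real.log_pos ha
  have hl0 := mul_log_lt_log_add ha ht0 ht1
  have hl1 : (1 - t) * Real.log a < Real.log ((1 - t) * a + t) := by
    have h := mul_log_lt_log_add ha (sub_pos.2 ht1) (sub_lt_self 1 ht0)
    rwa [sub_sub_cancel, add_comm t] at h
  rw [bregmanDist_eq_klConst_sub (a := a) hx, EReal.coe_lt_coe_iff]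
  · simp only [Matrix.cons_val_zero, Matrix.cons_val_one]
    have hmin : min (x 0) (x 1) * Real.log a
        ≤ x 0 * (t * Real.log a) + x 1 * ((1 - t) * Real.log a) := by
      have h : min (x 0) (x 1) ≤ x 0 * t + x 1 * (1 - t) := by
        nlinarith [mul_le_mul_of_nonneg_right (min_le_left (x 0) (x 1)) ht0.le,
          mul_le_mul_of_nonneg_right (min_le_right (x 0) (x 1)) (sub_pos.2 ht1).le]
      nlinarith [mul_le_mul_of_nonneg_right h hlog.le]
    have h0 := mul_le_mul_of_nonneg_left hl0.le (hx 0)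
    have h1 := mul_le_mul_of_nonneg_left hl1.le (hx 1)
    obtain ⟨j, hj⟩ := hx'
    fin_cases j
    · have := mul_lt_mul_of_pos_left hl0 hj
      simp only [Fin.zero_eta] at this
      linarith
    · have := mul_lt_mul_of_pos_left hl1 hj
      simp only [Fin.mk_one] at this
      linarith
  · rw [Fin.forall_fin_two]
    simp only [Matrix.cons_val_zero, Matrix.cons_val_one]
    constructor <;> nlinarith [mul_pos ht0 (one_pos.trans ha),
      mul_pos (sub_pos.2 ht1) (one_pos.trans ha)]
  · simp only [Matrix.cons_val_zero, Matrix.cons_val_one]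
    ring

theorem farthestDist_segmentC {a : ℝ} (ha : 1 < a) {x : EuclideanSpace ℝ (Fin 2)}
    (hx : ∀ j, 0 ≤ x j) :
    farthestDist (negEntropy 2) (segmentC a) x
      = ((klConst a x - min (x 0) (x 1) * Real.log a : ℝ) : EReal) := by
  have hlog : 0 < Real.log a := Real.log_pos ha
  refine le_antisymm (iSup₂_le fun c hc => ?_) ?_
  · by_cases hc₀ : c = c₀ a
    · rw [hc₀, bregmanDist_c₀ ha hx, EReal.coe_le_coe_iff]
      gcongr
      exact min_le_right _ _
    by_cases hc₁ : c = c₁ a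
    · rw [hc₁, bregmanDist_c₁ ha hx, EReal.coe_le_coe_iff]
      gcongr
      exact min_le_left _ _
    by_cases hx' : ∃ j, 0 < x j
    · exact (bregmanDist_lt_of_mem_segmentC ha hx hx' hc hc₀ hc₁).le
    -- At the origin the divergence is constant along the segment.
    · have hx0 : ∀ j, x j = 0 := fun j => le_antisymm (not_lt.1 fun h => hx' ⟨j, h⟩) (hx j)
      obtain ⟨t, ht0, ht1, rfl⟩ := mem_segmentC_iff.1 hc
      rw [bregmanDist_eq_klConst_sub (a := a) hx]
      · simp [hx0]
      · rw [Fin.forall_fin_two]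
        simp only [Matrix.cons_val_zero, Matrix.cons_val_one]
        constructor <;> nlinarith
      · simp only [Matrix.cons_val_zero, Matrix.cons_val_one]
        ring
  · rcases le_total (x 0) (x 1) with h | h
    · rw [min_eq_left h, ← bregmanDist_c₁ ha hx]
      exact le_iSup₂_of_le _ (c₁_mem_segmentC a) le_rfl
    · rw [min_eq_right h, ← bregmanDist_c₀ ha hx]
      exact le_iSup₂_of_le _ (c₀_mem_segmentC a) le_rfl

theorem mem_farthestPoints_segmentC_iff {a : ℝ} (ha : 1 < a) {x c : EuclideanSpace ℝ (Fin 2)}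
    (hx : ∀ j, 0 < x j) :
    c ∈ farthestPoints (negEntropy 2) (segmentC a) x
      ↔ (c = c₀ a ∧ x 1 ≤ x 0) ∨ (c = c₁ a ∧ x 0 ≤ x 1) := by
  have hx' : ∀ j, 0 ≤ x j := fun j => (hx j).le
  have hlog : Real.log a ≠ 0 := (Real.log_pos ha).ne'
  have hdom : x ∈ effDomain (negEntropy 2) := by rwa [effDomain_negEntropy]
  rw [farthestPoints, Set.mem_ofPred_eq, farthestDist_segmentC ha hx']
  by_cases hc₀ : c = c₀ a
  · subst hc₀
    rw [bregmanDist_c₀ ha hx', EReal.coe_eq_coe_iff]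
    simp [hdom, c₀_mem_segmentC, c₀_ne_c₁ ha, hlog, eq_comm (a := x 1)]
  by_cases hc₁ : c = c₁ a
  · subst hc₁
    rw [bregmanDist_c₁ ha hx', EReal.coe_eq_coe_iff]
    simp [hdom, c₁_mem_segmentC, (c₀_ne_c₁ ha).symm, hlog, eq_comm (a := x 0)]
  simp only [hc₀, hc₁, false_and, or_self, iff_false]
  rintro ⟨-, hc, h⟩
  exact (bregmanDist_lt_of_mem_segmentC ha hx' ⟨0, hx 0⟩ hc hc₀ hc₁).ne h

/-! ### The Chebyshev center -/

theorem mul_log_sub_add_pos {x s : ℝ} (hs : 0 < s) (hx : 0 ≤ x) (hxs : x ≠ s) :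
    0 < x * Real.log x - x * Real.log s - x + s := by
  rcases hx.eq_or_lt with rfl | hx
  · simpa using hs
  · have h := Real.log_lt_sub_one_of_pos (div_pos hs hx)
      (by rwa [ne_eq, div_eq_one_iff_eq hx.ne', eq_comm])
    have h' := mul_lt_mul_of_pos_left h hx
    rw [Real.log_div hs.ne' hx.ne', mul_sub, mul_sub, mul_div_cancel₀ _ hx.ne'] at h'
    linarith

theorem farthestDist_segmentC_eq_top {a : ℝ} {x : EuclideanSpace ℝ (Fin 2)}
    (hx : ¬ ∀ j, 0 ≤ x j) : farthestDist (negEntropy 2) (segmentC a) x = ⊤ := by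
  refine top_unique (le_iSup₂_of_le (c₀ a) (c₀_mem_segmentC a) ?_)
  have hx' : ¬ ((∀ j, 0 ≤ x j) ∧ ∀ j, 0 < c₀ a j) := fun h => hx h.1
  rw [bregmanDist_negEntropy, klDist, if_neg hx']

theorem farthestDist_center {a : ℝ} (ha : 1 < a) :
    farthestDist (negEntropy 2) (segmentC a) !₂[√a, √a] = ((1 + a - 2 * √a : ℝ) : EReal) := by
  rw [farthestDist_segmentC ha (by simp [Fin.forall_fin_two]), EReal.coe_eq_coe_iff, klConst]
  simp only [Matrix.cons_val_zero, Matrix.cons_val_one, min_self,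
    Real.log_sqrt (one_pos.trans ha).le]
  ring

theorem farthestDist_center_lt {a : ℝ} (ha : 1 < a) {x : EuclideanSpace ℝ (Fin 2)}
    (hx : x ≠ !₂[√a, √a]) :
    farthestDist (negEntropy 2) (segmentC a) !₂[√a, √a]
      < farthestDist (negEntropy 2) (segmentC a) x := by
  rw [farthestDist_center ha]
  by_cases hx0 : ∀ j, 0 ≤ x j
  · rw [farthestDist_segmentC ha hx0, EReal.coe_lt_coe_iff, klConst]
    have hs : 0 < √a := Real.sqrt_pos.2 (one_pos.trans ha)
    have hlogs : Real.log √a = Real.log a / 2 := Real.log_sqrt (one_pos.trans ha).le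
    have hpos : ∀ j, x j ≠ √a → 0 < x j * Real.log (x j) - x j * (Real.log a / 2) - x j + √a :=
      fun j h => hlogs ▸ mul_log_sub_add_pos hs (hx0 j) h
    have hnonneg : ∀ j, 0 ≤ x j * Real.log (x j) - x j * (Real.log a / 2) - x j + √a := by
      intro j
      by_cases h : x j = √a
      · rw [h, hlogs]
        linarith
      · exact (hpos j h).le
    have hmin : min (x 0) (x 1) * Real.log a ≤ (x 0 + x 1) / 2 * Real.log a := by
      refine mul_le_mul_of_nonneg_right ?_ (Real.log_pos ha).le
      linarith [min_le_left (x 0) (x 1), min_le_right (x 0) (x 1)]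
    have hne : x 0 ≠ √a ∨ x 1 ≠ √a := by
      by_contra! h
      refine hx ?_
      ext j
      fin_cases j
      · simpa using h.1
      · simpa using h.2
    rcases hne with h | h
    · linarith [hpos 0 h, hnonneg 1]
    · linarith [hpos 1 h, hnonneg 0]
  · rw [farthestDist_segmentC_eq_top hx0]
    exact EReal.coe_lt_top _

theorem isChebyshevCenter_segmentC {a : ℝ} (ha : 1 < a) :
    IsChebyshevCenter (negEntropy 2) (segmentC a) !₂[√a, √a] := by
  refine ⟨?_, Set.eq_singleton_iff_unique_mem.2 ⟨fun y => ?_, fun w hw => ?_⟩⟩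
  · simp [effDomain_negEntropy, Fin.forall_fin_two]
  · rcases eq_or_ne y !₂[√a, √a] with rfl | hy
    · exact le_rfl
    · exact (farthestDist_center_lt ha hy).le
  · by_contra h
    exact (hw !₂[√a, √a]).not_gt (farthestDist_center_lt ha h)

end RightBregman

theorem mainTheorem9 (a : ℝ) (ha : 1 < a) :
    -- the Bregman distance of the negative entropy is the Kullback-Leibler divergence
    (∀ x y : EuclideanSpace ℝ (Fin 2),
      RightBregman.bregmanDist (RightBregman.negEntropy 2) x y = RightBregman.klDist x y) ∧
    -- the interior of its domain is the open positive quadrant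
    interior (RightBregman.effDomain (RightBregman.negEntropy 2)) = {x | 0 < x 0 ∧ 0 < x 1} ∧
    -- the farthest points, for every `x` in that interior
    (∀ x ∈ interior (RightBregman.effDomain (RightBregman.negEntropy 2)),
      (x 1 < x 0 → RightBregman.farthestPoints (RightBregman.negEntropy 2)
        (RightBregman.segmentC a) x = {RightBregman.c₀ a}) ∧
      (x 0 < x 1 → RightBregman.farthestPoints (RightBregman.negEntropy 2)
        (RightBregman.segmentC a) x = {RightBregman.c₁ a}) ∧
      (x 0 = x 1 → RightBregman.farthestPoints (RightBregman.negEntropy 2)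
        (RightBregman.segmentC a) x = {RightBregman.c₀ a, RightBregman.c₁ a})) ∧
    -- the Chebyshev center, and that it is the geometric mean of the two end points
    RightBregman.IsChebyshevCenter (RightBregman.negEntropy 2) (RightBregman.segmentC a)
      !₂[√a, √a] ∧
    ∀ j, (!₂[√a, √a] : EuclideanSpace ℝ (Fin 2)) j
      = √(RightBregman.c₀ a j * RightBregman.c₁ a j) := by
  have hint : interior (RightBregman.effDomain (RightBregman.negEntropy 2))
      = {x | 0 < x 0 ∧ 0 < x 1} := by
    simp only [RightBregman.interior_effDomain_negEntropy, Fin.forall_fin_two]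
  refine ⟨RightBregman.bregmanDist_negEntropy, hint, fun x hx => ?_,
    RightBregman.isChebyshevCenter_segmentC ha, fun j => ?_⟩
  · rw [RightBregman.interior_effDomain_negEntropy] at hx
    refine ⟨fun h => ?_, fun h => ?_, fun h => ?_⟩ <;> ext c <;>
      rw [RightBregman.mem_farthestPoints_segmentC_iff ha hx]
    · simp [h.le, h.not_ge]
    · simp [h.le, h.not_ge]
    · simp [h]
  · fin_cases j <;> simp [RightBregman.c₀, RightBregman.c₁]
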